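/- Let $\Omega\subset\mathbb C$ be open and let $\mathcal E_1,\mathcal E_2$ be Hermitian holomorphic vector bundles over $\Omega$ (holomorphic vector bundles with a $C^\infty$ Hermitian metric on the fibers) of ranks $n$ and $m$. Let $\mathcal E_1\otimes\mathcal E_2$ be the tensor product bundle, with fibers $\mathcal E_1(w)\otimes\mathcal E_2(w)$ and the metric $\langle a\otimes b,c\otimes d\rangle=\langle a,c\rangle\langle b,d\rangle$. For a local holomorphic frame $\gamma=(\gamma_1,\dots,\gamma_r)$ of a Hermitian holomorphic bundle $\mathcal E$, with Gram matrix $h=(\langle\gamma_b,\gamma_a\rangle)_{a,b}$, the curvature has the matrix $\mathcal K=-\bar\partial(h^{-1}\partial h)$, and the covariant derivatives of a bundle map with matrix $\Phi$ have the matrices $\Phi_z=\partial\Phi+[h^{-1}\partial h,\Phi]$ and $\Phi_{\bar z}=\bar\partial\Phi$. Let $\mathcal K_{\mathcal E,z^i\bar z^j}$ be the bundle map obtained from $\mathcal K_{\mathcal E}$ by $i$ covariant derivatives in $z$ and $j$ in $\bar z$, taken in any prescribed order (the same for all bundles considered). Then, for all $i,j\ge 0$: 1. As bundle maps of $\mathcal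 E_1\otimes\mathcal E_2$, $$\mathcal K_{\mathcal E_1\otimes\mathcal E_2,z^i\bar z^j}=\mathcal K_{\mathcal E_1,z^i\bar z^j}\otimes \mathrm{id}_{\mathcal E_2}+\mathrm{id}_{\mathcal E_1}\otimes\mathcal K_{\mathcal E_2,z^i\bar z^j}.$$ 2. If $(e_s)_{s=1}^n$ and $(f_t)_{t=1}^m$ are holomorphic frames of $\mathcal E_1$ and $\mathcal E_2$ on an open set $U\subset\Omega$, then on $U$ the three bundle maps have, in the frames $(e_s)$, $(f_t)$ and $(e_s\otimes f_t)$, the matrices given by the formulas above, and these matrices satisfy $$\mathcal K_{\mathcal E_1\otimes\mathcal E_2,z^i\bar z^j}=\mathcal K_{\mathcal E_1,z^i\bar z^j}\otimes I_m+I_n\otimes\mathcal K_{\mathcal E_2,z^i\bar z^j}.$$ 3. In particular, if $\mathcal E_2$ is a line bundle ($m=1$), so that $\mathcal K_{\mathcal E_2,z^i\bar z^j}(w)$ is a scalar, then $$\operatorname{trace}\mathcal K_{\mathcal E_1\otimes\mathcal E_2,z^i\bar z^j}-\operatorname{trace}\mathcal K_{\mathcal E_1,z^i\bar z^j}=n\,\mathcal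 K_{\mathcal E_2,z^i\bar z^j}.$$ -/

import Mathlib

open scoped TensorProduct Manifold ContDiff Kronecker Bundle Topology
open Bundle Module

noncomputable section

/-! ### The tensor product of two vector bundles

For vector bundles `E₁`, `E₂` over `B` whose fibers are inner product spaces, the family of
fibers `E₁ x ⊗ E₂ x` (with the tensor product inner product
`⟪a ⊗ b, c ⊗ d⟫ = ⟪a, c⟫ * ⟪b, d⟫`) is made into a vector bundle, whose local trivializations are
the fiberwise tensor products of local trivializations of `E₁` and `E₂`. -/

section TensorBundle

section MapL

variable {𝕜 : Type*} [RCLike 𝕜]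

/-- A continuous bilinear map, from a bounded function that is linear in both arguments. -/
def bilinearMkCLM {X Y Z : Type*} [NormedAddCommGroup X] [NormedSpace 𝕜 X] [NormedAddCommGroup Y]
    [NormedSpace 𝕜 Y] [NormedAddCommGroup Z] [NormedSpace 𝕜 Z] (T : X → Y → Z)
    (h₁ : ∀ a a' b, T (a + a') b = T a b + T a' b) (h₂ : ∀ (c : 𝕜) a b, T (c • a) b = c • T a b)
    (h₃ : ∀ a b b', T a (b + b') = T a b + T a b') (h₄ : ∀ (c : 𝕜) a b, T a (c • b) = c • T a b)
    (h : ∀ a b, ‖T a b‖ ≤ ‖a‖ * ‖b‖) : X →L[𝕜] Y →L[𝕜] Z :=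
  LinearMap.mkContinuous₂ (LinearMap.mk₂ 𝕜 T h₁ h₂ h₃ h₄) 1
    (fun a b => by rw [one_mul]; exact h a b)

variable (𝕜) (F₁ F₂ G₁ G₂ : Type*)
  [NormedAddCommGroup F₁] [InnerProductSpace 𝕜 F₁] [NormedAddCommGroup F₂]
  [InnerProductSpace 𝕜 F₂] [NormedAddCommGroup G₁] [InnerProductSpace 𝕜 G₁]
  [NormedAddCommGroup G₂] [InnerProductSpace 𝕜 G₂]

/-- `(f, g) ↦ f ⊗ g` as a continuous bilinear map. -/
def tensorMapCLM :
    (F₁ →L[𝕜] G₁) →L[𝕜] (F₂ →L[𝕜] G₂) →L[𝕜] (F₁ ⊗[𝕜] F₂ →L[𝕜] G₁ ⊗[𝕜] G₂) :=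
  bilinearMkCLM (fun f g => TensorProduct.mapL f g)
    TensorProduct.mapL_add_left TensorProduct.mapL_smul_left
    TensorProduct.mapL_add_right TensorProduct.mapL_smul_right TensorProduct.norm_mapL_le

variable {𝕜 F₁ F₂ G₁ G₂}

theorem tensorMapCLM_apply (f : F₁ →L[𝕜] G₁) (g : F₂ →L[𝕜] G₂) :
    tensorMapCLM 𝕜 F₁ F₂ G₁ G₂ f g = TensorProduct.mapL f g := rfl

theorem mapL_mapL_of_comp_eq_id (f : F₁ →L[𝕜] G₁) (g : F₂ →L[𝕜] G₂) (f' : G₁ →L[𝕜] F₁)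
    (g' : G₂ →L[𝕜] F₂) (hf : ∀ v, f' (f v) = v) (hg : ∀ v, g' (g v) = v) (t : F₁ ⊗[𝕜] F₂) :
    TensorProduct.mapL f' g' (TensorProduct.mapL f g t) = t := by
  induction t using TensorProduct.induction_on with
  | zero => rw [map_zero, map_zero]
  | tmul a b => rw [TensorProduct.mapL_tmul, TensorProduct.mapL_tmul, hf, hg]
  | add x y hx hy => rw [map_add, map_add, hx, hy]

theorem contMDiffOn_bilinear {V : Type*} [NormedAddCommGroup V] [NormedSpace 𝕜 V]
    {H : Type*} [TopologicalSpace H] {I : ModelWithCorners 𝕜 V H}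
    {B : Type*} [TopologicalSpace B] [ChartedSpace H B] {k : WithTop ℕ∞}
    {X Y Z : Type*} [NormedAddCommGroup X] [NormedSpace 𝕜 X] [NormedAddCommGroup Y]
    [NormedSpace 𝕜 Y] [NormedAddCommGroup Z] [NormedSpace 𝕜 Z] (L : X →L[𝕜] Y →L[𝕜] Z)
    {f : B → X} {g : B → Y} {s : Set B} (hf : ContMDiffOn I 𝓘(𝕜, X) k f s)
    (hg : ContMDiffOn I 𝓘(𝕜, Y) k g s) : ContMDiffOn I 𝓘(𝕜, Z) k (fun x => L (f x) (g x)) s :=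
  ContMDiffOn.clm_apply (L.contMDiff.comp_contMDiffOn hf) hg

end MapL

variable {𝕜 : Type*} [RCLike 𝕜] {B : Type*} [TopologicalSpace B]
  {F₁ : Type*} [NormedAddCommGroup F₁] [InnerProductSpace 𝕜 F₁]
  {F₂ : Type*} [NormedAddCommGroup F₂] [InnerProductSpace 𝕜 F₂]
  {E₁ : B → Type*} [∀ x, NormedAddCommGroup (E₁ x)] [∀ x, InnerProductSpace 𝕜 (E₁ x)]
  [TopologicalSpace (TotalSpace F₁ E₁)]
  {E₂ : B → Type*} [∀ x, NormedAddCommGroup (E₂ x)] [∀ x, InnerProductSpace 𝕜 (E₂ x)]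
  [TopologicalSpace (TotalSpace F₂ E₂)]

namespace Bundle.Pretrivialization

/-- The fiberwise tensor product of two local trivializations. -/
def tensorProduct [FiberBundle F₁ E₁] [FiberBundle F₂ E₂]
    (e₁ : Trivialization F₁ (π F₁ E₁)) (e₂ : Trivialization F₂ (π F₂ E₂))
    [e₁.IsLinear 𝕜] [e₂.IsLinear 𝕜] :
    Pretrivialization (F₁ ⊗[𝕜] F₂) (π (F₁ ⊗[𝕜] F₂) (fun x => E₁ x ⊗[𝕜] E₂ x)) where
  toFun p := ⟨p.1, TensorProduct.mapL (e₁.continuousLinearMapAt 𝕜 p.1)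
    (e₂.continuousLinearMapAt 𝕜 p.1) p.2⟩
  invFun p := ⟨p.1, TensorProduct.mapL (e₁.symmL 𝕜 p.1) (e₂.symmL 𝕜 p.1) p.2⟩
  source := Bundle.TotalSpace.proj ⁻¹' (e₁.baseSet ∩ e₂.baseSet)
  target := (e₁.baseSet ∩ e₂.baseSet) ×ˢ Set.univ
  map_source' := fun ⟨_, _⟩ h => ⟨h, Set.mem_univ _⟩
  map_target' := fun ⟨_, _⟩ h => h.1
  left_inv' := fun ⟨x, t⟩ ⟨h₁, h₂⟩ =>
    congrArg (TotalSpace.mk x) (mapL_mapL_of_comp_eq_id (e₁.continuousLinearMapAt 𝕜 x)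
      (e₂.continuousLinearMapAt 𝕜 x) (e₁.symmL 𝕜 x) (e₂.symmL 𝕜 x)
      (fun v => e₁.symmL_continuousLinearMapAt h₁ v)
      (fun v => e₂.symmL_continuousLinearMapAt h₂ v) t)
  right_inv' := fun ⟨x, t⟩ ⟨⟨h₁, h₂⟩, _⟩ =>
    congrArg (Prod.mk x) (mapL_mapL_of_comp_eq_id (e₁.symmL 𝕜 x) (e₂.symmL 𝕜 x)
      (e₁.continuousLinearMapAt 𝕜 x) (e₂.continuousLinearMapAt 𝕜 x)
      (fun v => e₁.continuousLinearMapAt_symmL h₁ v)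
      (fun v => e₂.continuousLinearMapAt_symmL h₂ v) t)
  open_target := (e₁.open_baseSet.inter e₂.open_baseSet).prod isOpen_univ
  baseSet := e₁.baseSet ∩ e₂.baseSet
  open_baseSet := e₁.open_baseSet.inter e₂.open_baseSet
  source_eq := rfl
  target_eq := rfl
  proj_toFun _ _ := rfl

variable [FiberBundle F₁ E₁] [FiberBundle F₂ E₂]

theorem tensorProduct_isLinear (e₁ : Trivialization F₁ (π F₁ E₁))
    (e₂ : Trivialization F₂ (π F₂ E₂)) [e₁.IsLinear 𝕜] [e₂.IsLinear 𝕜] :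
    (tensorProduct (𝕜 := 𝕜) e₁ e₂).IsLinear 𝕜 where
  linear x _ :=
    { map_add s t := map_add (TensorProduct.mapL (e₁.continuousLinearMapAt 𝕜 x)
        (e₂.continuousLinearMapAt 𝕜 x)) s t
      map_smul c s := map_smul (TensorProduct.mapL (e₁.continuousLinearMapAt 𝕜 x)
        (e₂.continuousLinearMapAt 𝕜 x)) c s }

theorem tensorProduct_symm_apply (e₁ : Trivialization F₁ (π F₁ E₁))
    (e₂ : Trivialization F₂ (π F₂ E₂)) [e₁.IsLinear 𝕜] [e₂.IsLinear 𝕜] {x : B}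
    (hx : x ∈ e₁.baseSet ∩ e₂.baseSet) (t : F₁ ⊗[𝕜] F₂) :
    (tensorProduct (𝕜 := 𝕜) e₁ e₂).symm x t = TensorProduct.mapL (e₁.symmL 𝕜 x) (e₂.symmL 𝕜 x) t := by
  rw [symm_apply]
  · rfl
  · exact hx

theorem tensorProduct_coordChange (e₁ e₁' : Trivialization F₁ (π F₁ E₁))
    (e₂ e₂' : Trivialization F₂ (π F₂ E₂)) [e₁.IsLinear 𝕜] [e₂.IsLinear 𝕜]
    [e₁'.IsLinear 𝕜] [e₂'.IsLinear 𝕜] (x : B)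
    (hx : x ∈ (e₁.baseSet ∩ e₂.baseSet) ∩ (e₁'.baseSet ∩ e₂'.baseSet)) (t : F₁ ⊗[𝕜] F₂) :
    tensorMapCLM 𝕜 F₁ F₂ F₁ F₂ (e₁.coordChangeL 𝕜 e₁' x : F₁ →L[𝕜] F₁)
      (e₂.coordChangeL 𝕜 e₂' x : F₂ →L[𝕜] F₂) t =
      (tensorProduct (𝕜 := 𝕜) e₁' e₂' ⟨x, (tensorProduct (𝕜 := 𝕜) e₁ e₂).symm x t⟩).2 := by
  rw [tensorProduct_symm_apply e₁ e₂ hx.1, tensorMapCLM_apply]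
  change _ = TensorProduct.mapL (e₁'.continuousLinearMapAt 𝕜 x) (e₂'.continuousLinearMapAt 𝕜 x) _
  rw [← ContinuousLinearMap.comp_apply, ← TensorProduct.mapL_comp]
  congr 2
  · ext v
    simp [e₁.coordChangeL_apply e₁' ⟨hx.1.1, hx.2.1⟩, e₁.symmL_apply hx.1.1,
      e₁'.coe_linearMapAt_of_mem hx.2.1]
  · ext v
    simp [e₂.coordChangeL_apply e₂' ⟨hx.1.2, hx.2.2⟩, e₂.symmL_apply hx.1.2,
      e₂'.coe_linearMapAt_of_mem hx.2.2]

end Bundle.Pretrivialization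

open Bundle.Pretrivialization

variable (𝕜 F₁ E₁ F₂ E₂)
variable [FiberBundle F₁ E₁] [VectorBundle 𝕜 F₁ E₁] [FiberBundle F₂ E₂] [VectorBundle 𝕜 F₂ E₂]

/-- The local trivializations of the tensor product bundle. -/
def Bundle.Tensor.vectorPrebundle :
    VectorPrebundle 𝕜 (F₁ ⊗[𝕜] F₂) (fun x => E₁ x ⊗[𝕜] E₂ x) where
  pretrivializationAtlas :=
    {e | ∃ (e₁ : Trivialization F₁ (π F₁ E₁)) (e₂ : Trivialization F₂ (π F₂ E₂))
      (_ : MemTrivializationAtlas e₁) (_ : MemTrivializationAtlas e₂),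
        e = Pretrivialization.tensorProduct (𝕜 := 𝕜) e₁ e₂}
  pretrivialization_linear' := by
    rintro _ ⟨e₁, e₂, he₁, he₂, rfl⟩
    exact tensorProduct_isLinear e₁ e₂
  pretrivializationAt x :=
    Pretrivialization.tensorProduct (trivializationAt F₁ E₁ x) (trivializationAt F₂ E₂ x)
  mem_base_pretrivializationAt x :=
    ⟨mem_baseSet_trivializationAt F₁ E₁ x, mem_baseSet_trivializationAt F₂ E₂ x⟩
  pretrivialization_mem_atlas x :=
    ⟨trivializationAt F₁ E₁ x, trivializationAt F₂ E₂ x, inferInstance, inferInstance, rfl⟩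
  exists_coordChange := by
    rintro _ ⟨e₁, e₂, he₁, he₂, rfl⟩ _ ⟨e₁', e₂', he₁', he₂', rfl⟩
    refine ⟨_, ?_, tensorProduct_coordChange (𝕜 := 𝕜) e₁ e₁' e₂ e₂'⟩
    refine ContinuousOn.clm_apply ((tensorMapCLM 𝕜 F₁ F₂ F₁ F₂).continuous.comp_continuousOn
      ((continuousOn_coordChange 𝕜 e₁ e₁').mono ?_))
      ((continuousOn_coordChange 𝕜 e₂ e₂').mono ?_)
    · exact fun x hx => ⟨hx.1.1, hx.2.1⟩
    · exact fun x hx => ⟨hx.1.2, hx.2.2⟩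
  totalSpaceMk_isInducing := by
    intro b
    let L₁ : E₁ b ≃L[𝕜] F₁ := (trivializationAt F₁ E₁ b).continuousLinearEquivAt 𝕜 b
      (mem_baseSet_trivializationAt _ _ _)
    let L₂ : E₂ b ≃L[𝕜] F₂ := (trivializationAt F₂ E₂ b).continuousLinearEquivAt 𝕜 b
      (mem_baseSet_trivializationAt _ _ _)
    let φ : (E₁ b ⊗[𝕜] E₂ b) ≃L[𝕜] F₁ ⊗[𝕜] F₂ := ContinuousLinearEquiv.equivOfInverse
      (TensorProduct.mapL (L₁ : E₁ b →L[𝕜] F₁) (L₂ : E₂ b →L[𝕜] F₂))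
      (TensorProduct.mapL (L₁.symm : F₁ →L[𝕜] E₁ b) (L₂.symm : F₂ →L[𝕜] E₂ b))
      (fun t => mapL_mapL_of_comp_eq_id _ _ _ _ (fun v => L₁.symm_apply_apply v)
        (fun v => L₂.symm_apply_apply v) t)
      (fun t => mapL_mapL_of_comp_eq_id _ _ _ _ (fun v => L₁.apply_symm_apply v)
        (fun v => L₂.apply_symm_apply v) t)
    have h : Topology.IsInducing fun t => (b, φ t) :=
      Topology.isInducing_const_prod.mpr φ.toHomeomorph.isInducing
    convert! h using 1
    funext t
    change (b, TensorProduct.mapL ((trivializationAt F₁ E₁ b).continuousLinearMapAt 𝕜 b)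
      ((trivializationAt F₂ E₂ b).continuousLinearMapAt 𝕜 b) t) = (b, TensorProduct.mapL _ _ t)
    congr 3
    · ext v
      simp [L₁, (trivializationAt F₁ E₁ b).coe_linearMapAt_of_mem
        (mem_baseSet_trivializationAt F₁ E₁ b)]
    · ext v
      simp [L₂, (trivializationAt F₂ E₂ b).coe_linearMapAt_of_mem
        (mem_baseSet_trivializationAt F₂ E₂ b)]

instance Bundle.Tensor.topologicalSpaceTotalSpace :
    TopologicalSpace (TotalSpace (F₁ ⊗[𝕜] F₂) (fun x => E₁ x ⊗[𝕜] E₂ x)) :=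
  (Bundle.Tensor.vectorPrebundle 𝕜 F₁ F₂ E₁ E₂).totalSpaceTopology

instance Bundle.Tensor.fiberBundle :
    FiberBundle (F₁ ⊗[𝕜] F₂) (fun x => E₁ x ⊗[𝕜] E₂ x) :=
  (Bundle.Tensor.vectorPrebundle 𝕜 F₁ F₂ E₁ E₂).toFiberBundle

instance Bundle.Tensor.vectorBundle :
    VectorBundle 𝕜 (F₁ ⊗[𝕜] F₂) (fun x => E₁ x ⊗[𝕜] E₂ x) :=
  (Bundle.Tensor.vectorPrebundle 𝕜 F₁ F₂ E₁ E₂).toVectorBundle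

variable {V : Type*} [NormedAddCommGroup V] [NormedSpace 𝕜 V]
  {H : Type*} [TopologicalSpace H] {I : ModelWithCorners 𝕜 V H} [ChartedSpace H B]
  {k : WithTop ℕ∞}

instance Bundle.Tensor.vectorPrebundle_isContMDiff
    [ContMDiffVectorBundle k F₁ E₁ I] [ContMDiffVectorBundle k F₂ E₂ I] :
    (Bundle.Tensor.vectorPrebundle 𝕜 F₁ F₂ E₁ E₂).IsContMDiff I k where
  exists_contMDiffCoordChange := by
    rintro _ ⟨e₁, e₂, he₁, he₂, rfl⟩ _ ⟨e₁', e₂', he₁', he₂', rfl⟩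
    refine ⟨_, ?_, tensorProduct_coordChange (𝕜 := 𝕜) e₁ e₁' e₂ e₂'⟩
    refine contMDiffOn_bilinear (tensorMapCLM 𝕜 F₁ F₂ F₁ F₂) ((contMDiffOn_coordChangeL (IB := I) e₁ e₁').mono ?_)
      ((contMDiffOn_coordChangeL (IB := I) e₂ e₂').mono ?_)
    · exact fun x hx => ⟨hx.1.1, hx.2.1⟩
    · exact fun x hx => ⟨hx.1.2, hx.2.2⟩

/-- The tensor product of two holomorphic vector bundles is holomorphic. -/
instance Bundle.Tensor.contMDiffVectorBundle
    [ContMDiffVectorBundle k F₁ E₁ I] [ContMDiffVectorBundle k F₂ E₂ I] :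
    ContMDiffVectorBundle k (F₁ ⊗[𝕜] F₂) (fun x => E₁ x ⊗[𝕜] E₂ x) I :=
  (Bundle.Tensor.vectorPrebundle 𝕜 F₁ F₂ E₁ E₂).contMDiffVectorBundle I

end TensorBundle

/-! ### Hermitian holomorphic vector bundles over an open subset of the plane -/

section Hermitian

variable {Ω : TopologicalSpace.Opens ℂ}

/-- Let `E` be a vector bundle over `Ω` whose fibers carry inner products. Then `E` is a
*Hermitian holomorphic vector bundle* if its coordinate changes are holomorphic and if the inner
products of the fibers form a `C^∞` metric, that is, are `C^∞` functions (in the real sense) of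
the base point when they are read in local trivializations. -/
class IsHermitianHolomorphicBundle (F : Type*) [NormedAddCommGroup F] [NormedSpace ℂ F]
    (E : Ω → Type*) [∀ w, NormedAddCommGroup (E w)] [∀ w, InnerProductSpace ℂ (E w)]
    [TopologicalSpace (TotalSpace F E)] [FiberBundle F E] [VectorBundle ℂ F E] : Prop where
  holomorphic : ContMDiffVectorBundle ω F E 𝓘(ℂ, ℂ)
  smooth_metric : ∀ (e : Trivialization F (π F E)) [MemTrivializationAtlas e] (u v : F),
    ContMDiffOn 𝓘(ℝ, ℂ) 𝓘(ℝ, ℂ) ∞ (fun w => inner ℂ (e.symm w u) (e.symm w v)) e.baseSet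

/-- A family of sections `γ` is a holomorphic frame of `E` over `U` if every `γ a` is holomorphic
on `U` and the `γ a w` form a basis of `E w` for every `w ∈ U`. -/
abbrev IsHolomorphicFrameOn (F : Type*) [NormedAddCommGroup F] [NormedSpace ℂ F]
    {E : Ω → Type*} [∀ w, NormedAddCommGroup (E w)] [∀ w, InnerProductSpace ℂ (E w)]
    [TopologicalSpace (TotalSpace F E)] [FiberBundle F E]
    {ι : Type*} (γ : ι → (w : Ω) → E w) (U : Set Ω) : Prop :=
  IsLocalFrameOn 𝓘(ℂ, ℂ) F ω γ U

/-! ### Curvature and its covariant derivatives, computed in a frame -/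

/-- The real derivative of a function on the open set `Ω`, as a map `ℂ → ℂ`. -/
def realDeriv (f : Ω → ℂ) (w : Ω) : ℂ →L[ℝ] ℂ :=
  fderiv ℝ (Function.extend Subtype.val f 0) (w : ℂ)

/-- The two Wirtinger directions. -/
inductive WirtingerDir where
  /-- differentiation with respect to `z` -/
  | z : WirtingerDir
  /-- differentiation with respect to the conjugate of `z` -/
  | zbar : WirtingerDir
  deriving DecidableEq

/-- `∂ = (∂/∂x - i ∂/∂y) / 2`. -/
def wirtinger (f : Ω → ℂ) (w : Ω) : ℂ :=
  (realDeriv f w 1 - Complex.I * realDeriv f w Complex.I) / 2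

/-- `∂̄ = (∂/∂x + i ∂/∂y) / 2`. -/
def wirtingerBar (f : Ω → ℂ) (w : Ω) : ℂ :=
  (realDeriv f w 1 + Complex.I * realDeriv f w Complex.I) / 2

/-- Entrywise `∂` of a matrix valued function. -/
def matrixWirtinger {ι : Type*} (M : Ω → Matrix ι ι ℂ) (w : Ω) : Matrix ι ι ℂ :=
  Matrix.of fun a b => wirtinger (fun x => M x a b) w

/-- Entrywise `∂̄` of a matrix valued function. -/
def matrixWirtingerBar {ι : Type*} (M : Ω → Matrix ι ι ℂ) (w : Ω) : Matrix ι ι ℂ :=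
  Matrix.of fun a b => wirtingerBar (fun x => M x a b) w

variable {E : Ω → Type*} [∀ w, NormedAddCommGroup (E w)] [∀ w, InnerProductSpace ℂ (E w)]
  {ι : Type*} [Fintype ι] [DecidableEq ι]

/-- The Gram matrix `h` of a frame. In Mathlib the inner product is linear in its second argument,
so that the entry `(a, b)` of `h` is the inner product of `γ b` with `γ a`, linear in `γ b`. -/
def frameGram (γ : ι → (w : Ω) → E w) (w : Ω) : Matrix ι ι ℂ :=
  Matrix.gram ℂ (fun a => γ a w)

/-- The connection matrix `h⁻¹ ∂h`. -/
def connectionMatrix (γ : ι → (w : Ω) → E w) (w : Ω) : Matrix ι ι ℂ :=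
  (frameGram γ w)⁻¹ * matrixWirtinger (frameGram γ) w

/-- The covariant derivative of a bundle map with matrix `Φ` in the frame `γ`:
`Φ_z = ∂Φ + [h⁻¹ ∂h, Φ]` and `Φ_z̄ = ∂̄Φ`. -/
def covariantDerivMatrix (γ : ι → (w : Ω) → E w) (Φ : Ω → Matrix ι ι ℂ) :
    WirtingerDir → Ω → Matrix ι ι ℂ
  | .z, w => matrixWirtinger Φ w + (connectionMatrix γ w * Φ w - Φ w * connectionMatrix γ w)
  | .zbar, w => matrixWirtingerBar Φ w

/-- The matrix, in the frame `γ`, of the iterated covariant derivative of the curvature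
`K = -∂̄(h⁻¹ ∂h)` along a list of directions (the head of the list is applied last). With `i`
entries `z` and `j` entries `zbar` this is `K_{z^i z̄^j}`, the list recording the order in
which the derivatives are taken. -/
def curvatureMatrix (γ : ι → (w : Ω) → E w) : List WirtingerDir → Ω → Matrix ι ι ℂ
  | [] => fun w => -matrixWirtingerBar (connectionMatrix γ) w
  | d :: l => covariantDerivMatrix γ (curvatureMatrix γ l) d

end Hermitian

/-! ### Curvature and its covariant derivatives as bundle maps -/

/-- The iterated covariant derivative of the curvature of `E` as a bundle map `E w → E w`: the
endomorphism of `E w` whose matrix in the local holomorphic frame, given by the preferred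
trivialization of `E` at `w` (and some basis of the model fiber), is `curvatureMatrix`. (Every
local holomorphic frame around `w` gives the same endomorphism.) -/
def curvatureEnd {Ω : TopologicalSpace.Opens ℂ} (F : Type*) [NormedAddCommGroup F]
    [NormedSpace ℂ F] [FiniteDimensional ℂ F]
    (E : Ω → Type*) [∀ w, NormedAddCommGroup (E w)] [∀ w, InnerProductSpace ℂ (E w)]
    [TopologicalSpace (TotalSpace F E)] [FiberBundle F E] [VectorBundle ℂ F E]
    (l : List WirtingerDir) (w : Ω) : E w →ₗ[ℂ] E w :=
  let e := trivializationAt F E w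
  let b := Module.finBasis ℂ F
  let β := e.basisAt b (mem_baseSet_trivializationAt F E w)
  Matrix.toLin β β (curvatureMatrix (e.localFrame b) l w)

/-- The tensor product of two frames. -/
def tensorFrame {Ω : TopologicalSpace.Opens ℂ} {E₁ E₂ : Ω → Type*}
    [∀ w, NormedAddCommGroup (E₁ w)] [∀ w, InnerProductSpace ℂ (E₁ w)]
    [∀ w, NormedAddCommGroup (E₂ w)] [∀ w, InnerProductSpace ℂ (E₂ w)]
    {ι κ : Type*} (γ₁ : ι → (w : Ω) → E₁ w) (γ₂ : κ → (w : Ω) → E₂ w) :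
    ι × κ → (w : Ω) → E₁ w ⊗[ℂ] E₂ w :=
  fun p w => γ₁ p.1 w ⊗ₜ[ℂ] γ₂ p.2 w

/-- The tensor product of two Hermitian holomorphic bundles is a Hermitian holomorphic bundle. -/
instance Bundle.Tensor.isHermitianHolomorphicBundle {Ω : TopologicalSpace.Opens ℂ}
    (F₁ : Type*) [NormedAddCommGroup F₁] [InnerProductSpace ℂ F₁]
    (F₂ : Type*) [NormedAddCommGroup F₂] [InnerProductSpace ℂ F₂]
    (E₁ : Ω → Type*) [∀ w, NormedAddCommGroup (E₁ w)] [∀ w, InnerProductSpace ℂ (E₁ w)]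
    [TopologicalSpace (TotalSpace F₁ E₁)] [FiberBundle F₁ E₁] [VectorBundle ℂ F₁ E₁]
    (E₂ : Ω → Type*) [∀ w, NormedAddCommGroup (E₂ w)] [∀ w, InnerProductSpace ℂ (E₂ w)]
    [TopologicalSpace (TotalSpace F₂ E₂)] [FiberBundle F₂ E₂] [VectorBundle ℂ F₂ E₂]
    [h₁ : IsHermitianHolomorphicBundle F₁ E₁] [h₂ : IsHermitianHolomorphicBundle F₂ E₂] :
    IsHermitianHolomorphicBundle (F₁ ⊗[ℂ] F₂) (fun w => E₁ w ⊗[ℂ] E₂ w) where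
  holomorphic := by
    have := h₁.holomorphic
    have := h₂.holomorphic
    infer_instance
  smooth_metric := by
    rintro e ⟨_, ⟨e₁, e₂, he₁, he₂, rfl⟩, rfl⟩ u v
    have aux : ∀ u v : F₁ ⊗[ℂ] F₂, ContMDiffOn 𝓘(ℝ, ℂ) 𝓘(ℝ, ℂ) ∞
        (fun w => inner ℂ (TensorProduct.mapL (e₁.symmL ℂ w) (e₂.symmL ℂ w) u)
          (TensorProduct.mapL (e₁.symmL ℂ w) (e₂.symmL ℂ w) v)) (e₁.baseSet ∩ e₂.baseSet) := by
      intro u v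
      induction u using TensorProduct.induction_on with
      | zero => simp only [map_zero, inner_zero_left]; exact contMDiffOn_const
      | add x y hx hy => simp only [map_add, inner_add_left]; exact hx.add hy
      | tmul a b =>
        induction v using TensorProduct.induction_on with
        | zero => simp only [map_zero, inner_zero_right]; exact contMDiffOn_const
        | add x y hx hy => simp only [map_add, inner_add_right]; exact hx.add hy
        | tmul c d =>
          simp only [TensorProduct.mapL_tmul, TensorProduct.inner_tmul]
          refine ((contDiff_mul (𝕜 := ℝ) (𝔸 := ℂ)).contMDiff.comp_contMDiffOn
            (((h₁.smooth_metric e₁ a c).mono Set.inter_subset_left).prodMk_space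
            ((h₂.smooth_metric e₂ b d).mono Set.inter_subset_right))).congr ?_
          intro w hw
          simp only [Function.comp_apply, Trivialization.symmL_apply _ hw.1,
            Trivialization.symmL_apply _ hw.2]
    refine (aux u v).congr fun w hw => ?_
    have key : ∀ t : F₁ ⊗[ℂ] F₂, _ = TensorProduct.mapL (e₁.symmL ℂ w) (e₂.symmL ℂ w) t :=
      fun t => Pretrivialization.tensorProduct_symm_apply e₁ e₂ hw t
    rw [← key u, ← key v]
    rfl

end

/-!
Every quantity in the statement is local, and in a frame it is computed from the Gram matrix alone.
The proof is therefore a computation with matrices of `C^∞` functions on an open set, for which the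
entrywise Wirtinger derivatives satisfy the Leibniz rule.

*Independence of the frame.* If `A` is the matrix of a holomorphic change of frame, then the Gram
matrices satisfy `h' = Aᴴ h A`. Since `∂ Aᴴ = 0`, the connection matrices `θ = h⁻¹ ∂h` satisfy
`A θ' = θ A + ∂A`. Applying `∂̄`, which kills both `A` and `∂A`, gives `A K' = K A`, and the
covariant derivatives preserve this relation (`mul_curvatureMatrix_of_changeOfFrame`). Hence
`curvatureEnd` has the matrix `curvatureMatrix γ` in every holomorphic frame `γ`
(`IsHolomorphicFrameOn.toMatrix_curvatureEnd`). This applies to the frame `γ₁ ⊗ γ₂` too, because it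
is a holomorphic frame of the tensor product bundle (`isHolomorphicFrameOn_tensorFrame`).

*The derivation property.* The Gram matrix of `γ₁ ⊗ γ₂` is the Kronecker product `h₁ ⊗ h₂`, so the
Leibniz rule gives `θ = θ₁ ⊗ 1 + 1 ⊗ θ₂`. Then `K = K₁ ⊗ 1 + 1 ⊗ K₂`, and this form is preserved by
the covariant derivatives because the mixed terms of the commutator cancel
(`curvatureMatrix_tensorFrame`). The identity of bundle maps is its translation
(`curvatureEnd_tensor`), and the trace formula follows from `tr (S ⊗ T) = tr S * tr T`, an
endomorphism of a line being its trace times the identity.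
-/

/-! ### Wirtinger calculus of functions on an open subset of the plane -/

section WirtingerCalculus

variable {Ω : TopologicalSpace.Opens ℂ} {U : Set Ω} {f g : Ω → ℂ} {w : Ω}

/-- The extension by zero to `ℂ` of a function on `Ω`, the function that `realDeriv`
differentiates. -/
noncomputable def zeroExtend (f : Ω → ℂ) : ℂ → ℂ := Function.extend Subtype.val f 0

theorem zeroExtend_apply (f : Ω → ℂ) (w : Ω) : zeroExtend f w = f w :=
  Subtype.val_injective.extend_apply f 0 w

theorem realDeriv_eq (f : Ω → ℂ) (w : Ω) : realDeriv f w = fderiv ℝ (zeroExtend f) w := rfl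

/-- Near a point of an open set `U`, the extension by zero agrees with any function on `ℂ` that
agrees with `f` on `U`. -/
theorem zeroExtend_eventuallyEq (hU : IsOpen U) (hw : w ∈ U) {G : ℂ → ℂ}
    (h : ∀ x ∈ U, f x = G x) : zeroExtend f =ᶠ[𝓝 (w : ℂ)] G := by
  have hV : Subtype.val '' U ∈ 𝓝 (w : ℂ) :=
    (Ω.isOpen.isOpenEmbedding_subtypeVal.isOpenMap U hU).mem_nhds ⟨w, hw, rfl⟩
  filter_upwards [hV]
  rintro _ ⟨x, hx, rfl⟩
  rw [zeroExtend_apply, h x hx]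

theorem zeroExtend_eventuallyEq_of_forall {G : ℂ → ℂ} (h : ∀ x : Ω, f x = G x) :
    zeroExtend f =ᶠ[𝓝 (w : ℂ)] G :=
  zeroExtend_eventuallyEq isOpen_univ (Set.mem_univ w) fun x _ => h x

/-- `f` is `C^∞`, in the real sense, at the points of `U`. -/
def IsSmoothOn (f : Ω → ℂ) (U : Set Ω) : Prop :=
  ∀ w ∈ U, ContDiffAt ℝ ∞ (zeroExtend f) w

/-- `f` is holomorphic near every point of `U`. -/
def IsHolomorphicOn (f : Ω → ℂ) (U : Set Ω) : Prop :=
  ∀ w ∈ U, AnalyticAt ℂ (zeroExtend f) w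

theorem IsSmoothOn.mono {V : Set Ω} (hf : IsSmoothOn f U) (h : V ⊆ U) : IsSmoothOn f V :=
  fun w hw => hf w (h hw)

theorem IsSmoothOn.differentiableAt (hf : IsSmoothOn f U) (hw : w ∈ U) :
    DifferentiableAt ℝ (zeroExtend f) w :=
  (hf w hw).differentiableAt (by simp)

theorem IsSmoothOn.congr (hU : IsOpen U) (hf : IsSmoothOn f U) (h : ∀ x ∈ U, g x = f x) :
    IsSmoothOn g U := fun w hw =>
  (hf w hw).congr_of_eventuallyEq
    (zeroExtend_eventuallyEq hU hw fun x hx => by rw [h x hx, zeroExtend_apply])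

theorem isSmoothOn_const (c : ℂ) : IsSmoothOn (fun _ : Ω => c) U := fun _ _ =>
  contDiffAt_const.congr_of_eventuallyEq (zeroExtend_eventuallyEq_of_forall fun _ => rfl)

theorem zeroExtend_add : zeroExtend (fun x => f x + g x) =ᶠ[𝓝 (w : ℂ)]
    fun z => zeroExtend f z + zeroExtend g z :=
  zeroExtend_eventuallyEq_of_forall fun x => by simp only [zeroExtend_apply]

theorem zeroExtend_mul : zeroExtend (fun x => f x * g x) =ᶠ[𝓝 (w : ℂ)]
    fun z => zeroExtend f z * zeroExtend g z :=
  zeroExtend_eventuallyEq_of_forall fun x => by simp only [zeroExtend_apply]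

theorem zeroExtend_star : zeroExtend (fun x => star (f x)) =ᶠ[𝓝 (w : ℂ)]
    fun z => Complex.conjCLE (zeroExtend f z) :=
  zeroExtend_eventuallyEq_of_forall fun x => by simp [zeroExtend_apply]

theorem IsSmoothOn.add (hf : IsSmoothOn f U) (hg : IsSmoothOn g U) :
    IsSmoothOn (fun x => f x + g x) U := fun w hw =>
  ((hf w hw).add (hg w hw)).congr_of_eventuallyEq zeroExtend_add

theorem IsSmoothOn.mul (hf : IsSmoothOn f U) (hg : IsSmoothOn g U) :
    IsSmoothOn (fun x => f x * g x) U := fun w hw =>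
  ((hf w hw).mul (hg w hw)).congr_of_eventuallyEq zeroExtend_mul

theorem IsSmoothOn.neg (hf : IsSmoothOn f U) : IsSmoothOn (fun x => -f x) U := by
  simpa only [neg_one_mul] using (isSmoothOn_const (-1)).mul hf

theorem IsSmoothOn.sub (hf : IsSmoothOn f U) (hg : IsSmoothOn g U) :
    IsSmoothOn (fun x => f x - g x) U := by
  simpa only [sub_eq_add_neg] using hf.add hg.neg

theorem IsSmoothOn.star (hf : IsSmoothOn f U) : IsSmoothOn (fun x => star (f x)) U := fun w hw =>
  (Complex.conjCLE.contDiff.contDiffAt.comp (w : ℂ) (hf w hw)).congr_of_eventuallyEq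
    zeroExtend_star

theorem IsSmoothOn.inv (hf : IsSmoothOn f U) (h : ∀ x ∈ U, f x ≠ 0) :
    IsSmoothOn (fun x => (f x)⁻¹) U := fun w hw =>
  ((hf w hw).inv (by rw [zeroExtend_apply]; exact h w hw)).congr_of_eventuallyEq
    (zeroExtend_eventuallyEq_of_forall fun x => by rw [Pi.inv_apply, zeroExtend_apply])

theorem IsSmoothOn.sum {α : Type*} {s : Finset α} {F : α → Ω → ℂ}
    (h : ∀ a ∈ s, IsSmoothOn (F a) U) : IsSmoothOn (fun x => ∑ a ∈ s, F a x) U := by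
  classical
  induction s using Finset.induction_on with
  | empty => simpa using isSmoothOn_const 0
  | insert a s ha ih =>
    simp only [Finset.sum_insert ha]
    exact (h a (Finset.mem_insert_self a s)).add
      (ih fun b hb => h b (Finset.mem_insert_of_mem hb))

theorem IsSmoothOn.prod {α : Type*} {s : Finset α} {F : α → Ω → ℂ}
    (h : ∀ a ∈ s, IsSmoothOn (F a) U) : IsSmoothOn (fun x => ∏ a ∈ s, F a x) U := by
  classical
  induction s using Finset.induction_on with
  | empty => simpa using isSmoothOn_const 1
  | insert a s ha ih =>
    simp only [Finset.prod_insert ha]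
    exact (h a (Finset.mem_insert_self a s)).mul
      (ih fun b hb => h b (Finset.mem_insert_of_mem hb))

theorem IsSmoothOn.realDeriv_apply (hf : IsSmoothOn f U) (v : ℂ) :
    IsSmoothOn (fun x => realDeriv f x v) U := fun w hw =>
  (((hf w hw).fderiv_right (m := ∞) (by simp)).clm_apply contDiffAt_const).congr_of_eventuallyEq
    (zeroExtend_eventuallyEq_of_forall fun _ => rfl)

theorem IsHolomorphicOn.isSmoothOn (hf : IsHolomorphicOn f U) : IsSmoothOn f U := fun w hw =>
  ((hf w hw).contDiffAt (n := ∞)).restrict_scalars ℝ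

/-- The Wirtinger derivative `∂` or `∂̄`, according to the direction. -/
noncomputable def wirtingerDeriv : WirtingerDir → (Ω → ℂ) → Ω → ℂ
  | .z => wirtinger
  | .zbar => wirtingerBar

/-- `∂` and `∂̄` are `ℂ`-linear in the real derivative. The coefficients are values at `w`,
which covers the Leibniz rule. -/
theorem wirtingerDeriv_of_realDeriv {f₁ : Ω → ℂ} {c c' : ℂ} (d : WirtingerDir)
    (h : ∀ v, realDeriv f w v = c * realDeriv f₁ w v + c' * realDeriv g w v) :
    wirtingerDeriv d f w = c * wirtingerDeriv d f₁ w + c' * wirtingerDeriv d g w := by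
  cases d <;> simp only [wirtingerDeriv, wirtinger, wirtingerBar, h] <;> ring

theorem wirtingerDeriv_congr (hU : IsOpen U) (hw : w ∈ U) (h : ∀ x ∈ U, f x = g x)
    (d : WirtingerDir) : wirtingerDeriv d f w = wirtingerDeriv d g w := by
  have : realDeriv f w = realDeriv g w :=
    (zeroExtend_eventuallyEq hU hw (G := zeroExtend g) fun x hx => by
      rw [h x hx, zeroExtend_apply]).fderiv_eq
  cases d <;> simp only [wirtingerDeriv, wirtinger, wirtingerBar, this]

theorem wirtingerDeriv_const (c : ℂ) (d : WirtingerDir) :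
    wirtingerDeriv d (fun _ : Ω => c) w = 0 := by
  have : realDeriv (fun _ : Ω => c) w = 0 := by
    rw [realDeriv_eq, (zeroExtend_eventuallyEq_of_forall (G := fun _ => c) fun _ => rfl).fderiv_eq]
    simp
  cases d <;> simp [wirtingerDeriv, wirtinger, wirtingerBar, this]

theorem wirtingerDeriv_add (hf : IsSmoothOn f U) (hg : IsSmoothOn g U) (hw : w ∈ U)
    (d : WirtingerDir) : wirtingerDeriv d (fun x => f x + g x) w =
      wirtingerDeriv d f w + wirtingerDeriv d g w := by
  have := wirtingerDeriv_of_realDeriv (w := w) (f := fun x => f x + g x) (f₁ := f) (g := g)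
    (c := 1) (c' := 1) d fun v => by
      simp only [realDeriv_eq]
      rw [zeroExtend_add.fderiv_eq,
        fderiv_fun_add (hf.differentiableAt hw) (hg.differentiableAt hw)]
      simp
  simpa using this

theorem wirtingerDeriv_mul (hf : IsSmoothOn f U) (hg : IsSmoothOn g U) (hw : w ∈ U)
    (d : WirtingerDir) : wirtingerDeriv d (fun x => f x * g x) w =
      wirtingerDeriv d f w * g w + f w * wirtingerDeriv d g w := by
  rw [mul_comm _ (g w)]
  refine wirtingerDeriv_of_realDeriv d fun v => ?_
  simp only [realDeriv_eq]
  rw [zeroExtend_mul.fderiv_eq,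
    fderiv_fun_mul (hf.differentiableAt hw) (hg.differentiableAt hw)]
  simp [zeroExtend_apply]
  ring

theorem wirtingerDeriv_sum {α : Type*} {s : Finset α} {F : α → Ω → ℂ}
    (h : ∀ a ∈ s, IsSmoothOn (F a) U) (hw : w ∈ U) (d : WirtingerDir) :
    wirtingerDeriv d (fun x => ∑ a ∈ s, F a x) w = ∑ a ∈ s, wirtingerDeriv d (F a) w := by
  classical
  induction s using Finset.induction_on with
  | empty => simpa using wirtingerDeriv_const 0 d
  | insert a s ha ih =>
    have hs : ∀ b ∈ s, IsSmoothOn (F b) U := fun b hb => h b (Finset.mem_insert_of_mem hb)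
    simp only [Finset.sum_insert ha]
    rw [wirtingerDeriv_add (h a (Finset.mem_insert_self a s)) (.sum hs) hw, ih hs]

theorem IsSmoothOn.wirtingerDeriv (hf : IsSmoothOn f U) (d : WirtingerDir) :
    IsSmoothOn (wirtingerDeriv d f) U := by
  have h1 := hf.realDeriv_apply 1
  have h2 := (isSmoothOn_const Complex.I).mul (hf.realDeriv_apply Complex.I)
  cases d
  · exact (h1.sub h2).mul (isSmoothOn_const (2⁻¹))
  · exact (h1.add h2).mul (isSmoothOn_const (2⁻¹))

theorem IsHolomorphicOn.realDeriv_apply (hf : IsHolomorphicOn f U) (hw : w ∈ U) (v : ℂ) :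
    realDeriv f w v = deriv (zeroExtend f) w * v := by
  have := (hf w hw).differentiableAt.hasDerivAt.hasFDerivAt.restrictScalars ℝ
  rw [realDeriv_eq, this.fderiv]
  simp [mul_comm]

theorem IsHolomorphicOn.wirtinger_eq_deriv (hf : IsHolomorphicOn f U) (hw : w ∈ U) :
    wirtingerDeriv .z f w = deriv (zeroExtend f) w := by
  simp only [wirtingerDeriv, wirtinger, hf.realDeriv_apply hw]
  linear_combination (-1 / 2 * deriv (zeroExtend f) w) * Complex.I_mul_I

theorem IsHolomorphicOn.wirtingerBar_eq_zero (hf : IsHolomorphicOn f U) (hw : w ∈ U) :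
    wirtingerDeriv .zbar f w = 0 := by
  simp only [wirtingerDeriv, wirtingerBar, hf.realDeriv_apply hw]
  linear_combination (1 / 2 * deriv (zeroExtend f) w) * Complex.I_mul_I

theorem IsHolomorphicOn.wirtinger (hU : IsOpen U) (hf : IsHolomorphicOn f U) :
    IsHolomorphicOn (wirtingerDeriv .z f) U := fun w hw =>
  (hf w hw).deriv.congr
    (zeroExtend_eventuallyEq hU hw fun _ hx => hf.wirtinger_eq_deriv hx).symm

theorem IsHolomorphicOn.wirtinger_star_eq_zero (hf : IsHolomorphicOn f U) (hw : w ∈ U) :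
    wirtingerDeriv .z (fun x => star (f x)) w = 0 := by
  have h : ∀ v, realDeriv (fun x => star (f x)) w v = star (deriv (zeroExtend f) w * v) := by
    intro v
    have := Complex.conjCLE.hasFDerivAt.comp (w : ℂ)
      (hf.isSmoothOn.differentiableAt hw).hasFDerivAt
    rw [realDeriv_eq, zeroExtend_star.fderiv_eq]
    change fderiv ℝ (Complex.conjCLE ∘ zeroExtend f) w v = _
    rw [this.fderiv, ← hf.realDeriv_apply hw v]
    rfl
  simp only [wirtingerDeriv, _root_.wirtinger, h]
  simp only [Complex.star_def, map_mul, Complex.conj_I, map_one]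
  linear_combination (1 / 2 * (starRingEnd ℂ) (deriv (zeroExtend f) w)) * Complex.I_mul_I

theorem ContMDiffOn.isSmoothOn (hU : IsOpen U) (hf : ContMDiffOn 𝓘(ℝ, ℂ) 𝓘(ℝ, ℂ) ∞ f U) :
    IsSmoothOn f U := fun w hw => by
  have h := (hf w hw).contMDiffAt (hU.mem_nhds hw)
  have hf' : f = fun x : Ω => zeroExtend f x := funext fun x => (zeroExtend_apply f x).symm
  rw [hf', contMDiffAt_subtype_iff] at h
  exact h.contDiffAt

theorem ContMDiffOn.isHolomorphicOn (hU : IsOpen U)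
    (hf : ContMDiffOn 𝓘(ℂ, ℂ) 𝓘(ℂ, ℂ) ω f U) : IsHolomorphicOn f U := fun w hw => by
  have h := (hf w hw).contMDiffAt (hU.mem_nhds hw)
  have hf' : f = fun x : Ω => zeroExtend f x := funext fun x => (zeroExtend_apply f x).symm
  rw [hf', contMDiffAt_subtype_iff] at h
  exact h.contDiffAt.analyticAt

end WirtingerCalculus

/-! ### Wirtinger calculus of matrix valued functions -/

section MatrixCalculus

open scoped Matrix

variable {Ω : TopologicalSpace.Opens ℂ} {U : Set Ω} {w : Ω}
  {ι κ μ ν : Type*}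

/-- The entrywise Wirtinger derivative of a function with values in rectangular matrices. -/
noncomputable def matrixDeriv (d : WirtingerDir) (M : Ω → Matrix ι κ ℂ) (w : Ω) : Matrix ι κ ℂ :=
  Matrix.of fun a b => wirtingerDeriv d (fun x => M x a b) w

/-- The entries of `M` are `C^∞`, in the real sense, on `U`. -/
def IsSmoothMatrixOn (M : Ω → Matrix ι κ ℂ) (U : Set Ω) : Prop :=
  ∀ a b, IsSmoothOn (fun x => M x a b) U

/-- The entries of `M` are holomorphic on `U`. -/
def IsHolomorphicMatrixOn (M : Ω → Matrix ι κ ℂ) (U : Set Ω) : Prop :=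
  ∀ a b, IsHolomorphicOn (fun x => M x a b) U

theorem IsHolomorphicMatrixOn.isSmoothMatrixOn {M : Ω → Matrix ι κ ℂ}
    (hM : IsHolomorphicMatrixOn M U) : IsSmoothMatrixOn M U := fun a b => (hM a b).isSmoothOn

namespace IsSmoothMatrixOn

variable {M N : Ω → Matrix ι κ ℂ}

theorem mono {V : Set Ω} (hM : IsSmoothMatrixOn M U) (h : V ⊆ U) : IsSmoothMatrixOn M V :=
  fun a b => (hM a b).mono h

theorem congr (hU : IsOpen U) (hM : IsSmoothMatrixOn M U) (h : ∀ x ∈ U, N x = M x) :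
    IsSmoothMatrixOn N U := fun a b => (hM a b).congr hU fun x hx => by rw [h x hx]

theorem add (hM : IsSmoothMatrixOn M U) (hN : IsSmoothMatrixOn N U) :
    IsSmoothMatrixOn (fun x => M x + N x) U := fun a b => (hM a b).add (hN a b)

theorem neg (hM : IsSmoothMatrixOn M U) : IsSmoothMatrixOn (fun x => -M x) U :=
  fun a b => (hM a b).neg

theorem sub (hM : IsSmoothMatrixOn M U) (hN : IsSmoothMatrixOn N U) :
    IsSmoothMatrixOn (fun x => M x - N x) U := fun a b => (hM a b).sub (hN a b)

theorem mul [Fintype κ] {P : Ω → Matrix κ μ ℂ} (hM : IsSmoothMatrixOn M U)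
    (hP : IsSmoothMatrixOn P U) : IsSmoothMatrixOn (fun x => M x * P x) U := fun a b => by
  simp only [Matrix.mul_apply]
  exact .sum fun c _ => (hM a c).mul (hP c b)

theorem conjTranspose (hM : IsSmoothMatrixOn M U) : IsSmoothMatrixOn (fun x => (M x)ᴴ) U :=
  fun a b => (hM b a).star

theorem kronecker {P : Ω → Matrix μ ν ℂ} (hM : IsSmoothMatrixOn M U)
    (hP : IsSmoothMatrixOn P U) : IsSmoothMatrixOn (fun x => M x ⊗ₖ P x) U :=
  fun a b => (hM a.1 b.1).mul (hP a.2 b.2)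

theorem matrixDeriv (hM : IsSmoothMatrixOn M U) (d : WirtingerDir) :
    IsSmoothMatrixOn (matrixDeriv d M) U := fun a b => (hM a b).wirtingerDeriv d

theorem det [Fintype ι] [DecidableEq ι] {P : Ω → Matrix ι ι ℂ} (hP : IsSmoothMatrixOn P U) :
    IsSmoothOn (fun x => (P x).det) U := by
  simp only [Matrix.det_apply']
  exact .sum fun σ _ => (isSmoothOn_const _).mul (.prod fun a _ => hP (σ a) a)

theorem inv [Fintype ι] [DecidableEq ι] {P : Ω → Matrix ι ι ℂ} (hP : IsSmoothMatrixOn P U)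
    (h : ∀ x ∈ U, (P x).det ≠ 0) : IsSmoothMatrixOn (fun x => (P x)⁻¹) U := fun a b => by
  simp only [Matrix.inv_def, Matrix.smul_apply, smul_eq_mul, Ring.inverse_eq_inv',
    Matrix.adjugate_apply]
  refine (hP.det.inv h).mul (det fun c c' => ?_)
  by_cases hc : c = b
  · subst hc
    simpa using isSmoothOn_const _
  · simpa [Matrix.updateRow_ne hc] using hP c c'

end IsSmoothMatrixOn

theorem isSmoothMatrixOn_const (M : Matrix ι κ ℂ) : IsSmoothMatrixOn (fun _ : Ω => M) U :=
  fun a b => isSmoothOn_const (M a b)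

section Rules

variable {M N : Ω → Matrix ι κ ℂ} (d : WirtingerDir)

theorem matrixDeriv_congr (hU : IsOpen U) (hw : w ∈ U) (h : ∀ x ∈ U, M x = N x) :
    matrixDeriv d M w = matrixDeriv d N w := by
  ext a b
  exact wirtingerDeriv_congr hU hw (fun x hx => by rw [h x hx]) d

theorem matrixDeriv_const (M : Matrix ι κ ℂ) : matrixDeriv d (fun _ : Ω => M) w = 0 := by
  ext a b
  exact wirtingerDeriv_const _ d

theorem matrixDeriv_add (hM : IsSmoothMatrixOn M U) (hN : IsSmoothMatrixOn N U) (hw : w ∈ U) :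
    matrixDeriv d (fun x => M x + N x) w = matrixDeriv d M w + matrixDeriv d N w := by
  ext a b
  exact wirtingerDeriv_add (hM a b) (hN a b) hw d

theorem matrixDeriv_mul [Fintype κ] {P : Ω → Matrix κ μ ℂ} (hM : IsSmoothMatrixOn M U)
    (hP : IsSmoothMatrixOn P U) (hw : w ∈ U) :
    matrixDeriv d (fun x => M x * P x) w = matrixDeriv d M w * P w + M w * matrixDeriv d P w := by
  ext a b
  simp only [matrixDeriv, Matrix.of_apply, Matrix.mul_apply, Matrix.add_apply]
  rw [wirtingerDeriv_sum (fun c _ => (hM a c).mul (hP c b)) hw, ← Finset.sum_add_distrib]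
  exact Finset.sum_congr rfl fun c _ => wirtingerDeriv_mul (hM a c) (hP c b) hw d

theorem matrixDeriv_kronecker {P : Ω → Matrix μ ν ℂ} (hM : IsSmoothMatrixOn M U)
    (hP : IsSmoothMatrixOn P U) (hw : w ∈ U) :
    matrixDeriv d (fun x => M x ⊗ₖ P x) w =
      matrixDeriv d M w ⊗ₖ P w + M w ⊗ₖ matrixDeriv d P w := by
  ext a b
  exact wirtingerDeriv_mul (hM a.1 b.1) (hP a.2 b.2) hw d

end Rules

theorem neg_kronecker (M : Matrix ι κ ℂ) (N : Matrix μ ν ℂ) : (-M) ⊗ₖ N = -(M ⊗ₖ N) := by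
  ext a b
  simp [Matrix.kroneckerMap_apply]

theorem kronecker_neg (M : Matrix ι κ ℂ) (N : Matrix μ ν ℂ) : M ⊗ₖ (-N) = -(M ⊗ₖ N) := by
  ext a b
  simp [Matrix.kroneckerMap_apply]

namespace IsHolomorphicMatrixOn

variable {A : Ω → Matrix ι κ ℂ}

theorem matrixDeriv_zbar_eq_zero (hA : IsHolomorphicMatrixOn A U) (hw : w ∈ U) :
    matrixDeriv .zbar A w = 0 := by
  ext a b
  exact (hA a b).wirtingerBar_eq_zero hw

theorem matrixDeriv_z (hU : IsOpen U) (hA : IsHolomorphicMatrixOn A U) :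
    IsHolomorphicMatrixOn (matrixDeriv .z A) U := fun a b => (hA a b).wirtinger hU

theorem matrixDeriv_z_conjTranspose_eq_zero (hA : IsHolomorphicMatrixOn A U) (hw : w ∈ U) :
    matrixDeriv .z (fun x => (A x)ᴴ) w = 0 := by
  ext a b
  exact (hA b a).wirtinger_star_eq_zero hw

end IsHolomorphicMatrixOn

end MatrixCalculus

/-! ### Curvature matrices under change of frame and tensor products -/

section Curvature

open scoped Matrix

variable {Ω : TopologicalSpace.Opens ℂ} {U : Set Ω} {w : Ω}
  {E E' : Ω → Type*} [∀ w, NormedAddCommGroup (E w)] [∀ w, InnerProductSpace ℂ (E w)]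
  [∀ w, NormedAddCommGroup (E' w)] [∀ w, InnerProductSpace ℂ (E' w)]
  {ι κ : Type*} [Fintype ι] [DecidableEq ι] [Fintype κ] [DecidableEq κ]
  {γ : ι → (w : Ω) → E w} {γ' : κ → (w : Ω) → E' w}

theorem connectionMatrix_eq (γ : ι → (w : Ω) → E w) (w : Ω) :
    connectionMatrix γ w = (frameGram γ w)⁻¹ * matrixDeriv .z (frameGram γ) w := rfl

theorem curvatureMatrix_nil (γ : ι → (w : Ω) → E w) (w : Ω) :
    curvatureMatrix γ [] w = -matrixDeriv .zbar (connectionMatrix γ) w := rfl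

theorem curvatureMatrix_cons_z (γ : ι → (w : Ω) → E w) (l : List WirtingerDir) (w : Ω) :
    curvatureMatrix γ (.z :: l) w = matrixDeriv .z (curvatureMatrix γ l) w +
      (connectionMatrix γ w * curvatureMatrix γ l w -
        curvatureMatrix γ l w * connectionMatrix γ w) := rfl

theorem curvatureMatrix_cons_zbar (γ : ι → (w : Ω) → E w) (l : List WirtingerDir) (w : Ω) :
    curvatureMatrix γ (.zbar :: l) w = matrixDeriv .zbar (curvatureMatrix γ l) w := rfl

theorem isSmoothMatrixOn_connectionMatrix (hγ : IsSmoothMatrixOn (frameGram γ) U)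
    (hdet : ∀ x ∈ U, (frameGram γ x).det ≠ 0) : IsSmoothMatrixOn (connectionMatrix γ) U :=
  (hγ.inv hdet).mul (hγ.matrixDeriv .z)

theorem isSmoothMatrixOn_curvatureMatrix (hγ : IsSmoothMatrixOn (frameGram γ) U)
    (hdet : ∀ x ∈ U, (frameGram γ x).det ≠ 0) (l : List WirtingerDir) :
    IsSmoothMatrixOn (curvatureMatrix γ l) U := by
  have hθ := isSmoothMatrixOn_connectionMatrix hγ hdet
  induction l with
  | nil => exact (hθ.matrixDeriv .zbar).neg
  | cons d l ih =>
    cases d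
    · exact (ih.matrixDeriv .z).add ((hθ.mul ih).sub (ih.mul hθ))
    · exact ih.matrixDeriv .zbar

/-- Under a holomorphic change of frame `A` the connection matrix transforms as
`θ' = A⁻¹ θ A + A⁻¹ ∂A`. As `Aᴴ` is antiholomorphic, `∂` does not see it. -/
theorem mul_connectionMatrix_of_changeOfFrame (hU : IsOpen U) {A : Ω → Matrix ι κ ℂ}
    (hA : IsHolomorphicMatrixOn A U) (hAinv : ∀ x ∈ U, ∃ B : Matrix κ ι ℂ, A x * B = 1)
    (hγ : IsSmoothMatrixOn (frameGram γ) U) (hdet : ∀ x ∈ U, (frameGram γ x).det ≠ 0)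
    (hdet' : ∀ x ∈ U, (frameGram γ' x).det ≠ 0)
    (hgram : ∀ x ∈ U, frameGram γ' x = (A x)ᴴ * frameGram γ x * A x) (hw : w ∈ U) :
    A w * connectionMatrix γ' w = connectionMatrix γ w * A w + matrixDeriv .z A w := by
  obtain ⟨B, hB⟩ := hAinv w hw
  have hu : IsUnit (frameGram γ w).det := (hdet w hw).isUnit
  have hu' : IsUnit (frameGram γ' w).det := (hdet' w hw).isUnit
  have hB' : Bᴴ * (A w)ᴴ = 1 := by rw [← Matrix.conjTranspose_mul, hB, Matrix.conjTranspose_one]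
  have hAs := hA.isSmoothMatrixOn
  have hd : matrixDeriv .z (frameGram γ') w =
      (A w)ᴴ * (matrixDeriv .z (frameGram γ) w * A w + frameGram γ w * matrixDeriv .z A w) := by
    rw [matrixDeriv_congr .z hU hw hgram,
      matrixDeriv_mul .z (hAs.conjTranspose.mul hγ) hAs hw,
      matrixDeriv_mul .z hAs.conjTranspose hγ hw, hA.matrixDeriv_z_conjTranspose_eq_zero hw,
      Matrix.zero_mul, zero_add, Matrix.mul_add]
    simp only [Matrix.mul_assoc]
  have h1 : (A w)ᴴ * (frameGram γ w * (A w * connectionMatrix γ' w)) =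
      (A w)ᴴ * (matrixDeriv .z (frameGram γ) w * A w + frameGram γ w * matrixDeriv .z A w) := by
    rw [← hd, connectionMatrix_eq, ← Matrix.mul_assoc, ← Matrix.mul_assoc, ← Matrix.mul_assoc,
      ← hgram w hw, Matrix.mul_nonsing_inv _ hu', Matrix.one_mul]
  -- `Bᴴ` is a left inverse of `Aᴴ`, so the factor `Aᴴ h` on the left can be cancelled.
  have h2 := congrArg (fun X => (frameGram γ w)⁻¹ * (Bᴴ * X)) h1
  simp only [← Matrix.mul_assoc Bᴴ, hB', Matrix.one_mul] at h2
  rw [← Matrix.mul_assoc, Matrix.nonsing_inv_mul _ hu, Matrix.one_mul] at h2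
  rw [h2, connectionMatrix_eq, Matrix.mul_add, ← Matrix.mul_assoc, ← Matrix.mul_assoc,
    Matrix.nonsing_inv_mul _ hu, Matrix.one_mul]

/-- The matrices of the curvature and of its covariant derivatives are conjugated by a holomorphic
change of frame `A`. Stating this as `A K' = K A` avoids differentiating the inverse of `A`. -/
theorem mul_curvatureMatrix_of_changeOfFrame (hU : IsOpen U) {A : Ω → Matrix ι κ ℂ}
    (hA : IsHolomorphicMatrixOn A U) (hAinv : ∀ x ∈ U, ∃ B : Matrix κ ι ℂ, A x * B = 1)
    (hγ : IsSmoothMatrixOn (frameGram γ) U) (hdet : ∀ x ∈ U, (frameGram γ x).det ≠ 0)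
    (hdet' : ∀ x ∈ U, (frameGram γ' x).det ≠ 0)
    (hgram : ∀ x ∈ U, frameGram γ' x = (A x)ᴴ * frameGram γ x * A x)
    (l : List WirtingerDir) (hw : w ∈ U) :
    A w * curvatureMatrix γ' l w = curvatureMatrix γ l w * A w := by
  have hAs := hA.isSmoothMatrixOn
  have hγ' : IsSmoothMatrixOn (frameGram γ') U :=
    ((hAs.conjTranspose.mul hγ).mul hAs).congr hU hgram
  have hθ := isSmoothMatrixOn_connectionMatrix hγ hdet
  have hθ' := isSmoothMatrixOn_connectionMatrix hγ' hdet'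
  have hθθ' : ∀ x ∈ U, A x * connectionMatrix γ' x =
      connectionMatrix γ x * A x + matrixDeriv .z A x := fun x hx =>
    mul_connectionMatrix_of_changeOfFrame hU hA hAinv hγ hdet hdet' hgram hx
  induction l generalizing w with
  | nil =>
    have h := matrixDeriv_congr .zbar hU hw hθθ'
    rw [matrixDeriv_mul .zbar hAs hθ' hw, hA.matrixDeriv_zbar_eq_zero hw, Matrix.zero_mul,
      zero_add, matrixDeriv_add .zbar (hθ.mul hAs) (hAs.matrixDeriv .z) hw,
      matrixDeriv_mul .zbar hθ hAs hw, hA.matrixDeriv_zbar_eq_zero hw, Matrix.mul_zero, add_zero,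
      (hA.matrixDeriv_z hU).matrixDeriv_zbar_eq_zero hw, add_zero] at h
    rw [curvatureMatrix_nil, curvatureMatrix_nil, Matrix.mul_neg, h, Matrix.neg_mul]
  | cons d l ih =>
    have hK := isSmoothMatrixOn_curvatureMatrix hγ hdet l
    have hK' := isSmoothMatrixOn_curvatureMatrix hγ' hdet' l
    have h := matrixDeriv_congr d hU hw fun x hx => ih (w := x) hx
    rw [matrixDeriv_mul d hAs hK' hw, matrixDeriv_mul d hK hAs hw] at h
    cases d
    · rw [curvatureMatrix_cons_z, curvatureMatrix_cons_z]
      -- With `A θ' = θ A + ∂A`, the commutators produce `∂A K' - K ∂A`, which is exactly the defect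
      -- between `A ∂K'` and `∂K A` in the derivative `h` of `A K' = K A`.
      have h1 : A w * (connectionMatrix γ' w * curvatureMatrix γ' l w) =
          connectionMatrix γ w * (curvatureMatrix γ l w * A w) +
            matrixDeriv .z A w * curvatureMatrix γ' l w := by
        rw [← Matrix.mul_assoc, hθθ' w hw, Matrix.add_mul, Matrix.mul_assoc, ih hw]
      have h2 : A w * (curvatureMatrix γ' l w * connectionMatrix γ' w) =
          curvatureMatrix γ l w * (connectionMatrix γ w * A w + matrixDeriv .z A w) := by
        rw [← Matrix.mul_assoc, ih hw, Matrix.mul_assoc, hθθ' w hw]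
      have h3 := eq_sub_of_add_eq' h
      rw [Matrix.mul_add, Matrix.mul_sub, h1, h2, h3]
      simp only [Matrix.add_mul, Matrix.sub_mul, Matrix.mul_add, Matrix.mul_assoc]
      abel
    · rw [curvatureMatrix_cons_zbar, curvatureMatrix_cons_zbar]
      rwa [hA.matrixDeriv_zbar_eq_zero hw, Matrix.zero_mul, zero_add, Matrix.mul_zero,
        add_zero] at h

omit [Fintype ι] [DecidableEq ι] [Fintype κ] [DecidableEq κ] in
theorem frameGram_tensorFrame (γ : ι → (w : Ω) → E w) (γ' : κ → (w : Ω) → E' w) (w : Ω) :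
    frameGram (tensorFrame γ γ') w = frameGram γ w ⊗ₖ frameGram γ' w := by
  ext a b
  simp [frameGram, tensorFrame, Matrix.gram_apply, Matrix.kroneckerMap_apply,
    TensorProduct.inner_tmul]

/-- The connection of a tensor product: the Leibniz rule for `∂ (h₁ ⊗ h₂)`. -/
theorem connectionMatrix_tensorFrame
    (hγ : IsSmoothMatrixOn (frameGram γ) U) (hdet : ∀ x ∈ U, (frameGram γ x).det ≠ 0)
    (hγ' : IsSmoothMatrixOn (frameGram γ') U) (hdet' : ∀ x ∈ U, (frameGram γ' x).det ≠ 0)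
    (hw : w ∈ U) :
    connectionMatrix (tensorFrame γ γ') w =
      connectionMatrix γ w ⊗ₖ (1 : Matrix κ κ ℂ) + (1 : Matrix ι ι ℂ) ⊗ₖ connectionMatrix γ' w := by
  have hg : frameGram (tensorFrame γ γ') = fun x => frameGram γ x ⊗ₖ frameGram γ' x :=
    funext fun x => frameGram_tensorFrame γ γ' x
  rw [connectionMatrix_eq, hg, matrixDeriv_kronecker .z hγ hγ' hw, Matrix.inv_kronecker,
    Matrix.mul_add, ← Matrix.mul_kronecker_mul, ← Matrix.mul_kronecker_mul,
    Matrix.nonsing_inv_mul _ (hdet w hw).isUnit, Matrix.nonsing_inv_mul _ (hdet' w hw).isUnit]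
  rfl

/-- The derivation property in the frame `γ ⊗ γ'`. In the commutator with
`θ ⊗ 1 + 1 ⊗ θ'` the mixed terms `θ ⊗ K'` and `K ⊗ θ'` cancel. -/
theorem curvatureMatrix_tensorFrame (hU : IsOpen U)
    (hγ : IsSmoothMatrixOn (frameGram γ) U) (hdet : ∀ x ∈ U, (frameGram γ x).det ≠ 0)
    (hγ' : IsSmoothMatrixOn (frameGram γ') U) (hdet' : ∀ x ∈ U, (frameGram γ' x).det ≠ 0)
    (l : List WirtingerDir) (hw : w ∈ U) :
    curvatureMatrix (tensorFrame γ γ') l w =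
      curvatureMatrix γ l w ⊗ₖ (1 : Matrix κ κ ℂ) +
        (1 : Matrix ι ι ℂ) ⊗ₖ curvatureMatrix γ' l w := by
  -- The form `M ⊗ 1 + 1 ⊗ N` is preserved by both Wirtinger derivatives.
  have hd : ∀ (d : WirtingerDir) {X : Ω → Matrix (ι × κ) (ι × κ) ℂ} {M : Ω → Matrix ι ι ℂ}
      {N : Ω → Matrix κ κ ℂ} {x : Ω}, IsSmoothMatrixOn M U → IsSmoothMatrixOn N U → x ∈ U →
      (∀ y ∈ U, X y = M y ⊗ₖ (1 : Matrix κ κ ℂ) + (1 : Matrix ι ι ℂ) ⊗ₖ N y) →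
      matrixDeriv d X x = matrixDeriv d M x ⊗ₖ (1 : Matrix κ κ ℂ) +
        (1 : Matrix ι ι ℂ) ⊗ₖ matrixDeriv d N x := by
    intro d X M N x hM hN hx hX
    have h1 : IsSmoothMatrixOn (fun _ : Ω => (1 : Matrix ι ι ℂ)) U := isSmoothMatrixOn_const _
    have h2 : IsSmoothMatrixOn (fun _ : Ω => (1 : Matrix κ κ ℂ)) U := isSmoothMatrixOn_const _
    rw [matrixDeriv_congr d hU hx hX, matrixDeriv_add d (hM.kronecker h2) (h1.kronecker hN) hx,
      matrixDeriv_kronecker d hM h2 hx, matrixDeriv_kronecker d h1 hN hx, matrixDeriv_const,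
      matrixDeriv_const, Matrix.kronecker_zero, Matrix.zero_kronecker, add_zero, zero_add]
  have hθ := isSmoothMatrixOn_connectionMatrix hγ hdet
  have hθ' := isSmoothMatrixOn_connectionMatrix hγ' hdet'
  have hc : ∀ x ∈ U, connectionMatrix (tensorFrame γ γ') x =
      connectionMatrix γ x ⊗ₖ (1 : Matrix κ κ ℂ) +
        (1 : Matrix ι ι ℂ) ⊗ₖ connectionMatrix γ' x := fun x hx =>
    connectionMatrix_tensorFrame hγ hdet hγ' hdet' hx
  induction l generalizing w with
  | nil =>
    simp only [curvatureMatrix_nil]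
    rw [hd .zbar hθ hθ' hw hc, neg_add, neg_kronecker, kronecker_neg]
  | cons d l ih =>
    have hK := isSmoothMatrixOn_curvatureMatrix hγ hdet l
    have hK' := isSmoothMatrixOn_curvatureMatrix hγ' hdet' l
    have h := hd d hK hK' hw fun x hx => ih hx
    cases d
    · simp only [curvatureMatrix_cons_z]
      rw [h, ih hw, hc w hw]
      simp only [Matrix.add_mul, Matrix.mul_add, ← Matrix.mul_kronecker_mul, Matrix.mul_one,
        Matrix.one_mul, sub_eq_add_neg, Matrix.add_kronecker, Matrix.kronecker_add,
        neg_kronecker, kronecker_neg]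
      abel
    · exact h

end Curvature

/-! ### Holomorphic frames and the curvature as a bundle map -/

section Frames

open scoped Matrix

/-- The Gram matrix of a family of linear combinations `v' = v A` is `Aᴴ (gram v) A`. -/
theorem gram_sum_smul {V ι κ : Type*} [NormedAddCommGroup V] [InnerProductSpace ℂ V] [Fintype ι]
    (A : Matrix ι κ ℂ) {v : ι → V} {v' : κ → V} (h : ∀ j, v' j = ∑ i, A i j • v i) :
    Matrix.gram ℂ v' = Aᴴ * Matrix.gram ℂ v * A := by
  ext a b
  simp only [Matrix.gram_apply, h, Matrix.mul_apply, Matrix.conjTranspose_apply, inner_sum,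
    sum_inner, inner_smul_left, inner_smul_right, Finset.sum_mul, Finset.mul_sum]
  exact Finset.sum_congr rfl fun i _ => Finset.sum_congr rfl fun j _ => by
    simp only [Complex.star_def]
    ring

variable {Ω : TopologicalSpace.Opens ℂ} {U : Set Ω} {w : Ω}
  {F : Type*} [NormedAddCommGroup F] [NormedSpace ℂ F]
  {E : Ω → Type*} [∀ w, NormedAddCommGroup (E w)] [∀ w, InnerProductSpace ℂ (E w)]
  [TopologicalSpace (TotalSpace F E)] [FiberBundle F E]
  {ι κ : Type*}

theorem IsHolomorphicFrameOn.det_frameGram_ne_zero [Fintype κ] [DecidableEq κ]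
    {γ : κ → (w : Ω) → E w} (h : IsHolomorphicFrameOn F γ U) (hw : w ∈ U) :
    (frameGram γ w).det ≠ 0 :=
  Matrix.det_gram_ne_zero_iff_linearIndependent.mpr (h.linearIndependent hw)

variable [VectorBundle ℂ F E] (e : Trivialization F (π F E)) [MemTrivializationAtlas e]
  (b : Basis ι ℂ F)

/-- The matrix that expresses the sections `γ` in the frame of the trivialization `e` given by the
basis `b`. Outside of `e.baseSet` its values are junk. -/
noncomputable def changeOfFrame (γ : κ → (w : Ω) → E w) (w : Ω) : Matrix ι κ ℂ :=
  Matrix.of fun i j => b.repr (e ⟨w, γ j w⟩).2 i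

theorem changeOfFrame_eq_toMatrix (γ : κ → (w : Ω) → E w) (hw : w ∈ e.baseSet) :
    changeOfFrame e b γ w = (e.basisAt b hw).toMatrix (γ · w) := by
  ext i j
  simp [changeOfFrame, Basis.toMatrix_apply, Trivialization.basisAt]

variable [IsHermitianHolomorphicBundle F E]

theorem isSmoothMatrixOn_frameGram_localFrame :
    IsSmoothMatrixOn (frameGram (e.localFrame b)) e.baseSet := fun i j => by
  refine (ContMDiffOn.isSmoothOn e.open_baseSet
    (IsHermitianHolomorphicBundle.smooth_metric e (b i) (b j))).congr e.open_baseSet ?_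
  intro x hx
  simp [frameGram, Matrix.gram_apply, hx, Trivialization.basisAt]

theorem isHolomorphicFrameOn_localFrame :
    IsHolomorphicFrameOn F (e.localFrame b) e.baseSet :=
  have := IsHermitianHolomorphicBundle.holomorphic (F := F) (E := E)
  e.isLocalFrameOn_localFrame_baseSet 𝓘(ℂ, ℂ) ω b

variable [FiniteDimensional ℂ F] [Fintype ι] {γ : κ → (w : Ω) → E w}

omit [Fintype ι] in
theorem isHolomorphicMatrixOn_changeOfFrame (hU : IsOpen U) (h : IsHolomorphicFrameOn F γ U) :
    IsHolomorphicMatrixOn (changeOfFrame e b γ) (U ∩ e.baseSet) := fun i j => by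
  have := IsHermitianHolomorphicBundle.holomorphic (F := F) (E := E)
  have hV := hU.inter e.open_baseSet
  refine ContMDiffOn.isHolomorphicOn hV ?_
  have hj := (e.contMDiffOn_section_iff hV Set.inter_subset_right).mp
    ((h.contMDiffOn j).mono Set.inter_subset_left)
  exact (b.coord i).toContinuousLinearMap.contMDiff.comp_contMDiffOn hj

omit [IsHermitianHolomorphicBundle F E] [FiniteDimensional ℂ F] in
theorem frameGram_eq_changeOfFrame (γ : κ → (w : Ω) → E w) (hw : w ∈ e.baseSet) :
    frameGram γ w = (changeOfFrame e b γ w)ᴴ * frameGram (e.localFrame b) w *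
      changeOfFrame e b γ w := by
  refine gram_sum_smul _ fun j => ?_
  simp only [changeOfFrame_eq_toMatrix e b γ hw, Basis.toMatrix_apply, hw,
    Trivialization.localFrame_apply_of_mem_baseSet]
  exact ((e.basisAt b hw).sum_repr (γ j w)).symm

/-- The metric is smooth in every holomorphic frame, since it is in the frames of local
trivializations and the change of frame is holomorphic. -/
theorem IsHolomorphicFrameOn.isSmoothMatrixOn_frameGram (hU : IsOpen U)
    (h : IsHolomorphicFrameOn F γ U) : IsSmoothMatrixOn (frameGram γ) U := by
  intro i j w hw
  let e := trivializationAt F E w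
  let b := Module.finBasis ℂ F
  have hV := hU.inter e.open_baseSet
  have hA := (isHolomorphicMatrixOn_changeOfFrame e b hU h).isSmoothMatrixOn
  have hg := (isSmoothMatrixOn_frameGram_localFrame e b).mono
    (Set.inter_subset_right (s := U))
  exact ((hA.conjTranspose.mul hg).mul hA).congr hV
    (fun x hx => frameGram_eq_changeOfFrame e b γ hx.2) i j w
    ⟨hw, mem_baseSet_trivializationAt F E w⟩

/-- Independence of the frame: the bundle map `curvatureEnd`, defined by one particular frame, has
the matrix `curvatureMatrix γ` in every holomorphic frame `γ`. -/
theorem IsHolomorphicFrameOn.toMatrix_curvatureEnd [Fintype κ] [DecidableEq κ] (hU : IsOpen U)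
    (h : IsHolomorphicFrameOn F γ U) (l : List WirtingerDir) (hw : w ∈ U) :
    LinearMap.toMatrix (h.toBasisAt hw) (h.toBasisAt hw) (curvatureEnd F E l w) =
      curvatureMatrix γ l w := by
  let e := trivializationAt F E w
  let b := Module.finBasis ℂ F
  have hwe : w ∈ e.baseSet := mem_baseSet_trivializationAt F E w
  let β := e.basisAt b hwe
  have hβ : curvatureEnd F E l w = Matrix.toLin β β (curvatureMatrix (e.localFrame b) l w) := rfl
  have hA : ∀ x (hx : x ∈ U ∩ e.baseSet), changeOfFrame e b γ x =
      (e.basisAt b hx.2).toMatrix (h.toBasisAt hx.1) := fun x hx => by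
    rw [changeOfFrame_eq_toMatrix e b γ hx.2]
    congr 1
    ext j
    simp
  have key := mul_curvatureMatrix_of_changeOfFrame (γ := e.localFrame b) (γ' := γ)
    (hU.inter e.open_baseSet)
    (isHolomorphicMatrixOn_changeOfFrame e b hU h)
    (fun x hx => ⟨(h.toBasisAt hx.1).toMatrix (e.basisAt b hx.2), by
      rw [hA x hx, Basis.toMatrix_mul_toMatrix_flip]⟩)
    ((isSmoothMatrixOn_frameGram_localFrame e b).mono Set.inter_subset_right)
    (fun x hx => (isHolomorphicFrameOn_localFrame e b).det_frameGram_ne_zero hx.2)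
    (fun x hx => h.det_frameGram_ne_zero hx.1)
    (fun x hx => frameGram_eq_changeOfFrame e b γ hx.2) l ⟨hw, hwe⟩
  rw [hA w ⟨hw, hwe⟩] at key
  rw [← basis_toMatrix_mul_linearMap_toMatrix_mul_basis_toMatrix (b := h.toBasisAt hw) (b' := β)
    (c := h.toBasisAt hw) (c' := β), hβ, LinearMap.toMatrix_toLin, Matrix.mul_assoc, ← key,
    ← Matrix.mul_assoc, Basis.toMatrix_mul_toMatrix_flip, Matrix.one_mul]

end Frames

/-! ### Frames and curvature of the tensor product bundle -/

section TensorFrame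

variable {Ω : TopologicalSpace.Opens ℂ} {U : Set Ω} {w : Ω}
  {F₁ : Type*} [NormedAddCommGroup F₁] [InnerProductSpace ℂ F₁]
  {F₂ : Type*} [NormedAddCommGroup F₂] [InnerProductSpace ℂ F₂]
  {E₁ : Ω → Type*} [∀ w, NormedAddCommGroup (E₁ w)] [∀ w, InnerProductSpace ℂ (E₁ w)]
  [TopologicalSpace (TotalSpace F₁ E₁)] [FiberBundle F₁ E₁] [VectorBundle ℂ F₁ E₁]
  {E₂ : Ω → Type*} [∀ w, NormedAddCommGroup (E₂ w)] [∀ w, InnerProductSpace ℂ (E₂ w)]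
  [TopologicalSpace (TotalSpace F₂ E₂)] [FiberBundle F₂ E₂] [VectorBundle ℂ F₂ E₂]
  {ι κ : Type*} {γ₁ : ι → (w : Ω) → E₁ w} {γ₂ : κ → (w : Ω) → E₂ w}

/-- `(a, b) ↦ a ⊗ b` as a continuous bilinear map. -/
noncomputable def tmulCLM (F₁ F₂ : Type*) [NormedAddCommGroup F₁] [InnerProductSpace ℂ F₁]
    [NormedAddCommGroup F₂] [InnerProductSpace ℂ F₂] : F₁ →L[ℂ] F₂ →L[ℂ] F₁ ⊗[ℂ] F₂ :=
  bilinearMkCLM (fun a b => a ⊗ₜ[ℂ] b) TensorProduct.add_tmul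
    (fun c a b => (TensorProduct.smul_tmul' c a b).symm) TensorProduct.tmul_add
    (fun c a b => TensorProduct.tmul_smul c a b)
    (fun a b => (TensorProduct.norm_tmul a b).le)

variable [IsHermitianHolomorphicBundle F₁ E₁] [IsHermitianHolomorphicBundle F₂ E₂]

theorem isHolomorphicFrameOn_tensorFrame (hU : IsOpen U) (h₁ : IsHolomorphicFrameOn F₁ γ₁ U)
    (h₂ : IsHolomorphicFrameOn F₂ γ₂ U) :
    IsHolomorphicFrameOn (F₁ ⊗[ℂ] F₂) (E := fun w => E₁ w ⊗[ℂ] E₂ w) (tensorFrame γ₁ γ₂) U := by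
  have := IsHermitianHolomorphicBundle.holomorphic (F := F₁) (E := E₁)
  have := IsHermitianHolomorphicBundle.holomorphic (F := F₂) (E := E₂)
  have hb : ∀ {w} (hw : w ∈ U), (fun p => tensorFrame γ₁ γ₂ p w) =
      ⇑((h₁.toBasisAt hw).tensorProduct (h₂.toBasisAt hw)) := fun hw => by
    ext p
    simp [tensorFrame, Basis.tensorProduct_apply']
  refine ⟨fun {w} hw => ?_, fun {w} hw => ?_, fun p w hw => ContMDiffAt.contMDiffWithinAt ?_⟩
  · rw [hb hw]
    exact ((h₁.toBasisAt hw).tensorProduct (h₂.toBasisAt hw)).linearIndependent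
  · rw [hb hw]
    exact ((h₁.toBasisAt hw).tensorProduct (h₂.toBasisAt hw)).span_eq.ge
  · rw [contMDiffAt_section]
    let e₁ := trivializationAt F₁ E₁ w
    let e₂ := trivializationAt F₂ E₂ w
    have hV : IsOpen (U ∩ (e₁.baseSet ∩ e₂.baseSet)) :=
      hU.inter (e₁.open_baseSet.inter e₂.open_baseSet)
    have hs₁ := (e₁.contMDiffOn_section_iff hV fun x hx => hx.2.1).mp
      ((h₁.contMDiffOn p.1).mono Set.inter_subset_left)
    have hs₂ := (e₂.contMDiffOn_section_iff hV fun x hx => hx.2.2).mp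
      ((h₂.contMDiffOn p.2).mono Set.inter_subset_left)
    refine ((contMDiffOn_bilinear (tmulCLM F₁ F₂) hs₁ hs₂).congr ?_).contMDiffAt
      (hV.mem_nhds ⟨hw, mem_baseSet_trivializationAt F₁ E₁ w,
        mem_baseSet_trivializationAt F₂ E₂ w⟩)
    intro x hx
    -- The preferred trivialization of the tensor product bundle at `w` is, by definition, the
    -- fiberwise tensor product of `e₁` and `e₂`.
    change TensorProduct.mapL (e₁.continuousLinearMapAt ℂ x) (e₂.continuousLinearMapAt ℂ x)
      (γ₁ p.1 x ⊗ₜ γ₂ p.2 x) = (e₁ ⟨x, γ₁ p.1 x⟩).2 ⊗ₜ[ℂ] (e₂ ⟨x, γ₂ p.2 x⟩).2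
    rw [TensorProduct.mapL_tmul, Trivialization.continuousLinearMapAt_apply,
      Trivialization.continuousLinearMapAt_apply, e₁.linearMapAt_apply, e₂.linearMapAt_apply,
      if_pos hx.2.1, if_pos hx.2.2]

variable [Fintype ι] [DecidableEq ι] [Fintype κ] [DecidableEq κ]
  [FiniteDimensional ℂ F₁] [FiniteDimensional ℂ F₂]

theorem toMatrix_curvatureEnd_tensor (hU : IsOpen U) (h₁ : IsHolomorphicFrameOn F₁ γ₁ U)
    (h₂ : IsHolomorphicFrameOn F₂ γ₂ U) (l : List WirtingerDir) (hw : w ∈ U) :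
    LinearMap.toMatrix ((h₁.toBasisAt hw).tensorProduct (h₂.toBasisAt hw))
        ((h₁.toBasisAt hw).tensorProduct (h₂.toBasisAt hw))
        (curvatureEnd (F₁ ⊗[ℂ] F₂) (fun w => E₁ w ⊗[ℂ] E₂ w) l w) =
      curvatureMatrix (tensorFrame γ₁ γ₂) l w := by
  have h := isHolomorphicFrameOn_tensorFrame hU h₁ h₂
  have hb : (h₁.toBasisAt hw).tensorProduct (h₂.toBasisAt hw) = h.toBasisAt hw :=
    Basis.eq_of_apply_eq fun p => by simp [tensorFrame, Basis.tensorProduct_apply']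
  rw [hb]
  exact h.toMatrix_curvatureEnd hU l hw

theorem IsHolomorphicFrameOn.curvatureMatrix_tensorFrame (hU : IsOpen U)
    (h₁ : IsHolomorphicFrameOn F₁ γ₁ U) (h₂ : IsHolomorphicFrameOn F₂ γ₂ U)
    (l : List WirtingerDir) (hw : w ∈ U) :
    curvatureMatrix (tensorFrame γ₁ γ₂) l w =
      curvatureMatrix γ₁ l w ⊗ₖ (1 : Matrix κ κ ℂ) +
        (1 : Matrix ι ι ℂ) ⊗ₖ curvatureMatrix γ₂ l w :=
  _root_.curvatureMatrix_tensorFrame hU (h₁.isSmoothMatrixOn_frameGram hU)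
    (fun _ hx => h₁.det_frameGram_ne_zero hx) (h₂.isSmoothMatrixOn_frameGram hU)
    (fun _ hx => h₂.det_frameGram_ne_zero hx) l hw

variable (F₁ E₁ F₂ E₂) in
theorem curvatureEnd_tensor (l : List WirtingerDir) (w : Ω) :
    curvatureEnd (F₁ ⊗[ℂ] F₂) (fun w => E₁ w ⊗[ℂ] E₂ w) l w =
      TensorProduct.map (curvatureEnd F₁ E₁ l w) LinearMap.id +
        TensorProduct.map LinearMap.id (curvatureEnd F₂ E₂ l w) := by
  let e₁ := trivializationAt F₁ E₁ w
  let e₂ := trivializationAt F₂ E₂ w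
  have hU : IsOpen (e₁.baseSet ∩ e₂.baseSet) := e₁.open_baseSet.inter e₂.open_baseSet
  have h₁ : IsHolomorphicFrameOn F₁ (e₁.localFrame (Module.finBasis ℂ F₁))
      (e₁.baseSet ∩ e₂.baseSet) :=
    (isHolomorphicFrameOn_localFrame e₁ _).mono Set.inter_subset_left
  have h₂ : IsHolomorphicFrameOn F₂ (e₂.localFrame (Module.finBasis ℂ F₂))
      (e₁.baseSet ∩ e₂.baseSet) :=
    (isHolomorphicFrameOn_localFrame e₂ _).mono Set.inter_subset_right
  have hw : w ∈ e₁.baseSet ∩ e₂.baseSet :=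
    ⟨mem_baseSet_trivializationAt F₁ E₁ w, mem_baseSet_trivializationAt F₂ E₂ w⟩
  apply (LinearMap.toMatrix ((h₁.toBasisAt hw).tensorProduct (h₂.toBasisAt hw))
    ((h₁.toBasisAt hw).tensorProduct (h₂.toBasisAt hw))).injective
  rw [toMatrix_curvatureEnd_tensor hU h₁ h₂ l hw, h₁.curvatureMatrix_tensorFrame hU h₂ l hw,
    map_add, TensorProduct.toMatrix_map, TensorProduct.toMatrix_map, LinearMap.toMatrix_id,
    LinearMap.toMatrix_id, h₁.toMatrix_curvatureEnd hU, h₂.toMatrix_curvatureEnd hU]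

end TensorFrame

/-! ### Endomorphisms of a line, and the fibers of a bundle -/

theorem trace_smul_id_of_finrank_eq_one {V : Type*} [AddCommGroup V] [Module ℂ V]
    (h : Module.finrank ℂ V = 1) (T : V →ₗ[ℂ] V) :
    LinearMap.trace ℂ V T • (LinearMap.id : V →ₗ[ℂ] V) = T := by
  have := Module.finite_of_finrank_eq_succ h
  obtain ⟨c, rfl⟩ : ∃ c : ℂ, T = c • LinearMap.id := by
    have h1 : Module.finrank ℂ (V →ₗ[ℂ] V) = 1 := by rw [Module.finrank_linearMap, h]
    have : Nontrivial V := Module.nontrivial_of_finrank_eq_succ h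
    have h0 : (LinearMap.id : V →ₗ[ℂ] V) ≠ 0 := one_ne_zero (α := Module.End ℂ V)
    obtain ⟨c, hc⟩ := (finrank_eq_one_iff_of_nonzero' _ h0).mp h1 T
    exact ⟨c, hc.symm⟩
  rw [map_smul, LinearMap.trace_id, h]
  simp

theorem finrank_fiber {B F : Type*} {E : B → Type*} [TopologicalSpace B] [NormedAddCommGroup F]
    [NormedSpace ℂ F] [∀ x, NormedAddCommGroup (E x)] [∀ x, InnerProductSpace ℂ (E x)]
    [TopologicalSpace (TotalSpace F E)] [FiberBundle F E] [VectorBundle ℂ F E] (x : B) :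
    Module.finrank ℂ (E x) = Module.finrank ℂ F :=
  ((trivializationAt F E x).linearEquivAt ℂ x (mem_baseSet_trivializationAt F E x)).finrank_eq

theorem finiteDimensional_fiber {B F : Type*} {E : B → Type*} [TopologicalSpace B]
    [NormedAddCommGroup F] [NormedSpace ℂ F] [FiniteDimensional ℂ F]
    [∀ x, NormedAddCommGroup (E x)] [∀ x, InnerProductSpace ℂ (E x)]
    [TopologicalSpace (TotalSpace F E)] [FiberBundle F E] [VectorBundle ℂ F E] (x : B) :
    FiniteDimensional ℂ (E x) :=
  ((trivializationAt F E x).linearEquivAt ℂ x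
    (mem_baseSet_trivializationAt F E x)).symm.finiteDimensional

/-! ### Curvature of the tensor product of two Hermitian holomorphic bundles -/

theorem corollary5p8 {Ω : TopologicalSpace.Opens ℂ} {n m : ℕ}
    (E₁ : Ω → Type*) [∀ w, NormedAddCommGroup (E₁ w)] [∀ w, InnerProductSpace ℂ (E₁ w)]
    [TopologicalSpace (TotalSpace (EuclideanSpace ℂ (Fin n)) E₁)]
    [FiberBundle (EuclideanSpace ℂ (Fin n)) E₁] [VectorBundle ℂ (EuclideanSpace ℂ (Fin n)) E₁]
    [IsHermitianHolomorphicBundle (EuclideanSpace ℂ (Fin n)) E₁]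
    (E₂ : Ω → Type*) [∀ w, NormedAddCommGroup (E₂ w)] [∀ w, InnerProductSpace ℂ (E₂ w)]
    [TopologicalSpace (TotalSpace (EuclideanSpace ℂ (Fin m)) E₂)]
    [FiberBundle (EuclideanSpace ℂ (Fin m)) E₂] [VectorBundle ℂ (EuclideanSpace ℂ (Fin m)) E₂]
    [IsHermitianHolomorphicBundle (EuclideanSpace ℂ (Fin m)) E₂]
    (i j : ℕ) (l : List WirtingerDir)
    (hi : l.count .z = i) (hj : l.count .zbar = j) :
    (∀ w : Ω,
      curvatureEnd (EuclideanSpace ℂ (Fin n) ⊗[ℂ] EuclideanSpace ℂ (Fin m))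
          (fun w => E₁ w ⊗[ℂ] E₂ w) l w =
        TensorProduct.map (curvatureEnd (EuclideanSpace ℂ (Fin n)) E₁ l w) LinearMap.id +
        TensorProduct.map LinearMap.id (curvatureEnd (EuclideanSpace ℂ (Fin m)) E₂ l w)) ∧
    (∀ (U : Set Ω), IsOpen U → ∀ (γ₁ : Fin n → (w : Ω) → E₁ w) (γ₂ : Fin m → (w : Ω) → E₂ w)
      (h₁ : IsHolomorphicFrameOn (EuclideanSpace ℂ (Fin n)) γ₁ U)
      (h₂ : IsHolomorphicFrameOn (EuclideanSpace ℂ (Fin m)) γ₂ U), ∀ (w : Ω) (hw : w ∈ U),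
      LinearMap.toMatrix (h₁.toBasisAt hw) (h₁.toBasisAt hw)
          (curvatureEnd (EuclideanSpace ℂ (Fin n)) E₁ l w) = curvatureMatrix γ₁ l w ∧
      LinearMap.toMatrix (h₂.toBasisAt hw) (h₂.toBasisAt hw)
          (curvatureEnd (EuclideanSpace ℂ (Fin m)) E₂ l w) = curvatureMatrix γ₂ l w ∧
      LinearMap.toMatrix ((h₁.toBasisAt hw).tensorProduct (h₂.toBasisAt hw))
          ((h₁.toBasisAt hw).tensorProduct (h₂.toBasisAt hw))
          (curvatureEnd (EuclideanSpace ℂ (Fin n) ⊗[ℂ] EuclideanSpace ℂ (Fin m))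
            (fun w => E₁ w ⊗[ℂ] E₂ w) l w) =
        curvatureMatrix (tensorFrame γ₁ γ₂) l w ∧
      curvatureMatrix (tensorFrame γ₁ γ₂) l w =
        curvatureMatrix γ₁ l w ⊗ₖ (1 : Matrix (Fin m) (Fin m) ℂ) +
        (1 : Matrix (Fin n) (Fin n) ℂ) ⊗ₖ curvatureMatrix γ₂ l w) ∧
    (m = 1 → ∀ w : Ω,
      (LinearMap.trace ℂ (E₁ w ⊗[ℂ] E₂ w)
          (curvatureEnd (EuclideanSpace ℂ (Fin n) ⊗[ℂ] EuclideanSpace ℂ (Fin m))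
            (fun w => E₁ w ⊗[ℂ] E₂ w) l w) -
        LinearMap.trace ℂ (E₁ w) (curvatureEnd (EuclideanSpace ℂ (Fin n)) E₁ l w)) •
          (LinearMap.id : E₂ w →ₗ[ℂ] E₂ w) =
        (n : ℂ) • curvatureEnd (EuclideanSpace ℂ (Fin m)) E₂ l w) := by
  refine ⟨fun w => curvatureEnd_tensor _ _ E₁ E₂ l w, ?_, ?_⟩
  · intro U hU γ₁ γ₂ h₁ h₂ w hw
    exact ⟨h₁.toMatrix_curvatureEnd hU l hw, h₂.toMatrix_curvatureEnd hU l hw,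
      toMatrix_curvatureEnd_tensor hU h₁ h₂ l hw, h₁.curvatureMatrix_tensorFrame hU h₂ l hw⟩
  · rintro rfl w
    have hf₁ := finrank_fiber (F := EuclideanSpace ℂ (Fin n)) (E := E₁) w
    have hf₂ := finrank_fiber (F := EuclideanSpace ℂ (Fin 1)) (E := E₂) w
    rw [finrank_euclideanSpace_fin] at hf₁ hf₂
    have := finiteDimensional_fiber (F := EuclideanSpace ℂ (Fin n)) (E := E₁) w
    have := finiteDimensional_fiber (F := EuclideanSpace ℂ (Fin 1)) (E := E₂) w
    rw [curvatureEnd_tensor, map_add, LinearMap.trace_tensorProduct',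
      LinearMap.trace_tensorProduct', LinearMap.trace_id, LinearMap.trace_id, hf₁, hf₂,
      Nat.cast_one, mul_one, add_sub_cancel_left, mul_smul, trace_smul_id_of_finrank_eq_one hf₂]
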